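/- For positive integers $M$ and $n$, let $\mathcal{T}[M\times n]$ be the set of tableaux of size $M\times n$: the surjective maps $T:\{1,\dots,M\}\to\{1,\dots,n\}$ such that, writing $x_T(y)$ for the smallest preimage of $y$ under $T$, one has $x_T(1)<x_T(2)<\dots<x_T(n)$. For an integer-valued function $\hat f$ on $\{1,\dots,n\}$, let $\mathcal{T}[M\times n;\hat f]$ be the set of those $T\in\mathcal{T}[M\times n]$ with $x_T(y)\le\hat f(y)$ for all $1\le y\le n$. Fix an integer $k\ge 2$, and for integers $N$ and $n$ put $\hat f^{\emptyset}(y)=\hat f^{\emptyset}_{N,n}(y):=N-k(n-y+1)$; for $N=kn+1$ this is $k(y-1)+1$, and the elements of $\mathcal{T}[N\times n;\hat f^{\emptyset}]$ are the $k$-Dyck tableaux. Let $N=N(n)$, $B=B(n)$, $\ell=\ell(n)$ be non-negative integers with $N=\mathcal{O}(n)$, $B=\mathcal{O}(1)$, $\sqrt n=o(\ell)$ as $n\to\infty$ and $M:=N-B\ge 0$, and let $\hat f=\hat f_n$ be an integer-valued function on $\{1,\dots,n\}$ such that, for all sufficiently large $n$, $\hat f(y)=\hat f^{\emptyset}(y)$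 for all $y\le\ell$, $\hat f(y)=\hat f^{\emptyset}(y)-B$ for all $y\ge n-\ell$, and $\hat f^{\emptyset}(y)-B\le\hat f(y)\le\hat f^{\emptyset}(y)$ for all $1\le y\le n$. Then, as $n\to\infty$, $$\frac{\big|\mathcal{T}[M\times n;\hat f]\big|}{\big|\mathcal{T}[M\times n]\big|}-\frac{\big|\mathcal{T}[N\times n;\hat f^{\emptyset}]\big|}{\big|\mathcal{T}[N\times n]\big|}=o(1),$$ where a ratio whose denominator is zero is read as $0$. -/

import Mathlib

open Filter Asymptotics

/-- The column (counted from `1`) of the leftmost mark in row `y`: the smallest preimage of `y`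
under `T`, where column `x : Fin M` is the column number `x + 1`. -/
noncomputable def firstCol {M n : ℕ} (T : Fin M → Fin n) (y : Fin n) : ℕ :=
  sInf {c : ℕ | ∃ x : Fin M, T x = y ∧ c = (x : ℕ) + 1}

/-- The tableaux of size `M × n`: the surjective maps from the `M` columns to the `n` rows
whose smallest preimages increase strictly from each row to the next. -/
def tableaux (M n : ℕ) : Set (Fin M → Fin n) :=
  {T | Function.Surjective T ∧ StrictMono (firstCol T)}

/-- The tableaux of size `M × n` whose backbone function is dominated by `f`. The bound `f` takes
row numbers in `{1, …, n}`, so that row `y : Fin n` is the row number `y + 1`. -/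
def tableauxBelow (M n : ℕ) (f : ℕ → ℤ) : Set (Fin M → Fin n) :=
  {T | T ∈ tableaux M n ∧ ∀ y : Fin n, (firstCol T y : ℤ) ≤ f ((y : ℕ) + 1)}

/-- The bound `y ↦ N - k (n - y + 1)`. For `N = k n + 1` it is `y ↦ k (y - 1) + 1`, and the
`N × n` tableaux dominated by it are the `k`-Dyck tableaux. -/
def dyckBound (k N n : ℕ) (y : ℕ) : ℤ :=
  (N : ℤ) - (k : ℤ) * ((n : ℤ) - (y : ℤ) + 1)

/-- The proportion of the tableaux of size `M × n` that are dominated by `f`. -/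
noncomputable def proportionBelow (M n : ℕ) (f : ℕ → ℤ) : ℝ :=
  ((tableauxBelow M n f).ncard : ℝ) / ((tableaux M n).ncard : ℝ)

/-! Read a uniform tableau from its last column backwards. Deleting the last column gives a Markov
chain on sizes `(m, y)`, started at `(M, n)`, in which the row number drops with probability
`newProb`, a ratio of Stirling numbers of the second kind. A proportion of dominated tableaux is
then the probability `walkProb` that this chain respects the bound at every drop.

Only the last `J` columns matter, for a constant `J` depending on `ε` (`exists_window`). Since `M`
is at least about `k n`, the drop probability is strictly below `1 / k`. Hence `excess` has negative
drift and an exponential moment makes late violations in the rows above a small multiple of `n`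
unlikely. In the remaining low rows drift estimates are lost; there the function `pairProb`, of
order `1 / n` at the start but at least of order `1 / y` at a violation in row `y`, bounds the
probability of a violation. Both estimates are combined into one superharmonic function in
`walkProb_sub_le`.

On the last `J` columns `f` is the Dyck bound shifted by `B`, so the chains from `M` and from `M +
B` columns face the same rule relative to their ends. Their transition probabilities differ by `O(1
/ n)` per step (`abs_newProb_sub_add_le`), so the two success probabilities differ by `O(J / n)`. -/

/-! ### Counting tableaux column by column -/

theorem isLeast_firstCol {M n : ℕ} {T : Fin M → Fin n} {y : Fin n} (h : y ∈ Set.range T) :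
    IsLeast {c : ℕ | ∃ x : Fin M, T x = y ∧ c = (x : ℕ) + 1} (firstCol T y) := by
  obtain ⟨x, hx⟩ := h
  have hne : {c : ℕ | ∃ x : Fin M, T x = y ∧ c = (x : ℕ) + 1}.Nonempty := ⟨_, x, hx, rfl⟩
  exact ⟨Nat.sInf_mem hne, fun c hc => Nat.sInf_le hc⟩

theorem firstCol_eq_of_isLeast {M n : ℕ} {T : Fin M → Fin n} {y : Fin n} {c : ℕ}
    (h : IsLeast {c : ℕ | ∃ x : Fin M, T x = y ∧ c = (x : ℕ) + 1} c) : firstCol T y = c := by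
  obtain ⟨x, hx, -⟩ := h.1
  exact (isLeast_firstCol ⟨x, hx⟩).unique h

theorem one_le_firstCol {M n : ℕ} {T : Fin M → Fin n} {y : Fin n} (h : y ∈ Set.range T) :
    1 ≤ firstCol T y := by
  obtain ⟨x, -, hx⟩ := (isLeast_firstCol h).1
  omega

theorem firstCol_le {M n : ℕ} {T : Fin M → Fin n} {y : Fin n} (h : y ∈ Set.range T) :
    firstCol T y ≤ M := by
  obtain ⟨x, -, hx⟩ := (isLeast_firstCol h).1
  omega

/-- Appending a column whose mark lies in any row does not change the first mark of a row
that is already hit. -/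
theorem firstCol_snoc {M n : ℕ} {T : Fin M → Fin n} {y : Fin n} (h : y ∈ Set.range T)
    (v : Fin n) : firstCol (Fin.snoc T v : Fin (M + 1) → Fin n) y = firstCol T y := by
  have hT := isLeast_firstCol h
  refine firstCol_eq_of_isLeast ⟨?_, ?_⟩
  · obtain ⟨x, hx, hc⟩ := hT.1
    exact ⟨x.castSucc, by simpa using hx, by simpa using hc⟩
  · rintro c ⟨x, hx, rfl⟩
    induction x using Fin.lastCases with
    | last => simpa using (firstCol_le h).trans (Nat.le_succ M)
    | cast x =>
      rw [Fin.snoc_castSucc] at hx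
      exact hT.2 ⟨x, hx, by simp⟩

theorem firstCol_castSucc_comp {M n : ℕ} {T : Fin M → Fin n} {y : Fin n} :
    firstCol (fun x => (T x).castSucc) y.castSucc = firstCol T y := by
  simp [firstCol]

theorem firstCol_snoc_self {M n : ℕ} {T : Fin M → Fin n} {v : Fin n} (h : v ∉ Set.range T) :
    firstCol (Fin.snoc T v : Fin (M + 1) → Fin n) v = M + 1 := by
  refine firstCol_eq_of_isLeast ⟨⟨Fin.last M, by simp, by simp⟩, ?_⟩
  rintro c ⟨x, hx, rfl⟩
  induction x using Fin.lastCases with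
  | last => simp
  | cast x =>
    rw [Fin.snoc_castSucc] at hx
    exact absurd ⟨x, hx⟩ h

/-- The tableaux in which the pairs (first column of a row, row number) satisfy `A`. -/
def tableauxWith (A : ℕ → ℕ → Prop) (M n : ℕ) : Set (Fin M → Fin n) :=
  {T | T ∈ tableaux M n ∧ ∀ y : Fin n, A (firstCol T y) ((y : ℕ) + 1)}

theorem snoc_mem_tableauxWith {A : ℕ → ℕ → Prop} {M n : ℕ} {T : Fin M → Fin n}
    (hT : Function.Surjective T) (v : Fin n) :
    (Fin.snoc T v : Fin (M + 1) → Fin n) ∈ tableauxWith A (M + 1) n ↔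
      T ∈ tableauxWith A M n := by
  have key : firstCol (Fin.snoc T v : Fin (M + 1) → Fin n) = firstCol T :=
    funext fun y => firstCol_snoc (hT y) v
  have hs : Function.Surjective (Fin.snoc T v : Fin (M + 1) → Fin n) := fun y => by
    obtain ⟨x, hx⟩ := hT y
    exact ⟨x.castSucc, by simpa using hx⟩
  simp only [tableauxWith, tableaux, Set.mem_ofPred_eq, key, hs, hT]

/-- Appending a column whose mark opens a new row. -/
theorem snoc_castSucc_mem_tableauxWith {A : ℕ → ℕ → Prop} {M n : ℕ} {T : Fin M → Fin n}
    (hT : Function.Surjective T) :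
    (Fin.snoc (fun x => (T x).castSucc) (Fin.last n) : Fin (M + 1) → Fin (n + 1)) ∈
        tableauxWith A (M + 1) (n + 1) ↔
      T ∈ tableauxWith A M n ∧ A (M + 1) (n + 1) := by
  set T' : Fin (M + 1) → Fin (n + 1) := Fin.snoc (fun x => (T x).castSucc) (Fin.last n) with hT'
  have h1 : ∀ y : Fin n, firstCol T' y.castSucc = firstCol T y := fun y => by
    rw [hT', firstCol_snoc, firstCol_castSucc_comp]
    obtain ⟨x, hx⟩ := hT y
    exact ⟨x, by simp [hx]⟩
  have h2 : firstCol T' (Fin.last n) = M + 1 := by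
    refine firstCol_snoc_self ?_
    rintro ⟨x, hx⟩
    exact absurd hx (Fin.castSucc_lt_last _).ne
  have hs : Function.Surjective T' := fun y => by
    induction y using Fin.lastCases with
    | last => exact ⟨Fin.last M, by simp [hT']⟩
    | cast y =>
      obtain ⟨x, hx⟩ := hT y
      exact ⟨x.castSucc, by simp [hT', hx]⟩
  have h3 : StrictMono (firstCol T') ↔ StrictMono (firstCol T) := by
    constructor
    · intro h a b hab
      rw [← h1, ← h1]
      exact h (by simpa using hab)
    · intro h a b hab
      induction b using Fin.lastCases with
      | last =>
        induction a using Fin.lastCases with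
        | last => exact absurd hab (lt_irrefl _)
        | cast a =>
          rw [h1, h2]
          exact Nat.lt_succ_of_le (firstCol_le (hT a))
      | cast b =>
        induction a using Fin.lastCases with
        | last => exact absurd hab (Fin.castSucc_lt_last b).not_gt
        | cast a =>
          rw [h1, h1]
          exact h (by simpa using hab)
  simp only [tableauxWith, tableaux, Set.mem_ofPred_eq, h3, hs, hT, true_and, Fin.forall_fin_succ',
    h1, h2, Fin.val_castSucc, Fin.val_last, and_assoc]

/-- If deleting the last column empties a row, that row has its first mark in the largest column, so
strict monotonicity forces it to be the top row. This is the second case of the recursion for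
`walkCount`. -/
theorem eq_last_of_not_surjective {A : ℕ → ℕ → Prop} {M n : ℕ} {T : Fin M → Fin (n + 1)}
    {v : Fin (n + 1)} (hT : ¬ Function.Surjective T)
    (h : (Fin.snoc T v : Fin (M + 1) → Fin (n + 1)) ∈ tableauxWith A (M + 1) (n + 1)) :
    v = Fin.last n ∧ ∃ T' : Fin M → Fin n, Function.Surjective T' ∧
      T = fun x => (T' x).castSucc := by
  obtain ⟨⟨hs, hmono⟩, -⟩ := h
  have hr : ∀ y, y ≠ v → y ∈ Set.range T := fun y hy => by
    obtain ⟨x, hx⟩ := hs y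
    induction x using Fin.lastCases with
    | last => exact absurd (by simpa using hx.symm) hy
    | cast x => exact ⟨x, by simpa using hx⟩
  have hv : v ∉ Set.range T := fun hv => hT fun y => by
    by_cases hy : y = v
    · exact hy ▸ hv
    · exact hr y hy
  have hlast : v = Fin.last n := by
    by_contra hne
    have h1 := hmono (Fin.lt_last_iff_ne_last.2 hne)
    rw [firstCol_snoc_self hv, firstCol_snoc (hr _ (Ne.symm hne))] at h1
    have := firstCol_le (hr _ (Ne.symm hne))
    omega
  subst hlast
  have hne : ∀ x, T x ≠ Fin.last n := fun x hx => hv ⟨x, hx⟩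
  refine ⟨rfl, fun x => (T x).castPred (hne x), fun y => ?_, by simp⟩
  obtain ⟨x, hx⟩ := hr y.castSucc (Fin.castSucc_lt_last y).ne
  exact ⟨x, by simp [hx]⟩

open Classical in
/-- The number of tableaux in which every pair (first column of a row, row number) satisfies `A`,
computed column by column. -/
noncomputable def walkCount (A : ℕ → ℕ → Prop) : ℕ → ℕ → ℕ
  | 0, 0 => 1
  | 0, _ + 1 => 0
  | _ + 1, 0 => 0
  | m + 1, y + 1 => (y + 1) * walkCount A m (y + 1) + if A (m + 1) (y + 1) then walkCount A m y else 0

theorem ncard_tableauxWith (A : ℕ → ℕ → Prop) :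
    ∀ M n : ℕ, (tableauxWith A M n).ncard = walkCount A M n
  | 0, 0 => by
    have : tableauxWith A 0 0 = Set.univ := by
      ext T
      simp [tableauxWith, tableaux, Function.Surjective, StrictMono]
    simp [this, walkCount, Set.ncard_univ]
  | 0, n + 1 => by
    have : tableauxWith A 0 (n + 1) = ∅ := by
      ext T
      simp only [Set.mem_empty_iff_false, iff_false]
      intro h
      obtain ⟨x, -⟩ := h.1.1 0
      exact x.elim0
    simp [this, walkCount]
  | M + 1, 0 => by
    have : tableauxWith A (M + 1) 0 = ∅ := by
      ext T
      exact (T 0).elim0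
    simp [this, walkCount]
  | M + 1, n + 1 => by
    classical
    have ih1 := ncard_tableauxWith A M (n + 1)
    have ih2 := ncard_tableauxWith A M n
    let F : (Fin M → Fin (n + 1)) × Fin (n + 1) → Fin (M + 1) → Fin (n + 1) :=
      fun q => Fin.snoc q.1 q.2
    let G : (Fin M → Fin n) → Fin (M + 1) → Fin (n + 1) :=
      fun T => Fin.snoc (fun x => (T x).castSucc) (Fin.last n)
    have hF : Function.Injective F := by
      rintro ⟨a, v⟩ ⟨b, w⟩ h
      have := Fin.snoc_injective2 h
      exact Prod.ext this.1 this.2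
    have hG : Function.Injective G := by
      intro a b h
      have := (Fin.snoc_injective2 h).1
      funext x
      exact Fin.castSucc_injective _ (congrFun this x)
    let U : Set (Fin M → Fin n) := {T | T ∈ tableauxWith A M n ∧ A (M + 1) (n + 1)}
    have hU : U.ncard = if A (M + 1) (n + 1) then walkCount A M n else 0 := by
      by_cases hA : A (M + 1) (n + 1) <;> simp [U, hA, ih2]
    -- `F` adds a mark to any existing row and imposes no new condition; `G` opens the top row and
    -- imposes `A` there.
    have hsplit : tableauxWith A (M + 1) (n + 1) =
        F '' (tableauxWith A M (n + 1) ×ˢ Set.univ) ∪ G '' U := by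
      ext T
      constructor
      · intro hT
        have hTs : T = Fin.snoc (Fin.init T) (T (Fin.last M)) := (Fin.snoc_init_self T).symm
        rw [hTs] at hT
        by_cases hs : Function.Surjective (Fin.init T : Fin M → Fin (n + 1))
        · exact Or.inl ⟨(Fin.init T, T (Fin.last M)),
            ⟨(snoc_mem_tableauxWith hs _).1 hT, trivial⟩, hTs.symm⟩
        · obtain ⟨hv, T', hT', hTT'⟩ := eq_last_of_not_surjective hs hT
          rw [hv, hTT', snoc_castSucc_mem_tableauxWith hT'] at hT
          refine Or.inr ⟨T', hT, ?_⟩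
          rw [hTs, hv, hTT']
      · rintro (⟨⟨T', v⟩, ⟨hT', -⟩, rfl⟩ | ⟨T', hT', rfl⟩)
        · exact (snoc_mem_tableauxWith hT'.1.1 v).2 hT'
        · exact (snoc_castSucc_mem_tableauxWith hT'.1.1.1).2 hT'
    have hdisj : Disjoint (F '' (tableauxWith A M (n + 1) ×ˢ Set.univ)) (G '' U) := by
      rw [Set.disjoint_left]
      rintro _ ⟨⟨T', v⟩, ⟨hT', -⟩, rfl⟩ ⟨T'', -, h⟩
      obtain ⟨x, hx⟩ := hT'.1.1 (Fin.last n)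
      have h1 : (T'' x).castSucc = T' x := congrFun (Fin.snoc_injective2 h).1 x
      exact absurd (h1.trans hx) (Fin.castSucc_lt_last _).ne
    rw [hsplit, Set.ncard_union_eq hdisj (Set.toFinite _) (Set.toFinite _),
      Set.ncard_image_of_injective _ hF, Set.ncard_image_of_injective _ hG, Set.ncard_prod, ih1, hU,
      walkCount, Set.ncard_univ]
    simp [mul_comm]

theorem walkCount_true : ∀ m y : ℕ, walkCount (fun _ _ => True) m y = Nat.stirlingSecond m y
  | 0, 0 => by simp [walkCount]
  | 0, y + 1 => by simp [walkCount]
  | m + 1, 0 => by simp [walkCount]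
  | m + 1, y + 1 => by
    simp [walkCount, Nat.stirlingSecond_succ_succ, walkCount_true m y, walkCount_true m (y + 1)]

theorem walkCount_le (A : ℕ → ℕ → Prop) :
    ∀ m y : ℕ, walkCount A m y ≤ Nat.stirlingSecond m y
  | 0, 0 => by simp [walkCount]
  | 0, y + 1 => by simp [walkCount]
  | m + 1, 0 => by simp [walkCount]
  | m + 1, y + 1 => by
    rw [walkCount, Nat.stirlingSecond_succ_succ]
    refine Nat.add_le_add (Nat.mul_le_mul_left _ (walkCount_le A m (y + 1))) ?_
    split_ifs
    · exact walkCount_le A m y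
    · exact Nat.zero_le _

theorem proportionBelow_eq (M n : ℕ) (f : ℕ → ℤ) :
    proportionBelow M n f =
      (walkCount (fun x y => (x : ℤ) ≤ f y) M n : ℝ) / (Nat.stirlingSecond M n : ℝ) := by
  have h1 : tableauxBelow M n f = tableauxWith (fun x y => (x : ℤ) ≤ f y) M n := rfl
  have h2 : tableaux M n = tableauxWith (fun _ _ => True) M n := by
    ext T
    simp [tableauxWith]
  rw [proportionBelow, h1, h2, ncard_tableauxWith, ncard_tableauxWith, walkCount_true]

theorem proportionBelow_eq_zero {M n : ℕ} {f : ℕ → ℤ} (hn : 1 ≤ n) (hf : f 1 ≤ 0) :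
    proportionBelow M n f = 0 := by
  have : tableauxBelow M n f = ∅ := by
    ext T
    simp only [Set.mem_empty_iff_false, iff_false]
    rintro ⟨hT, h⟩
    have h1 := h ⟨0, hn⟩
    have h2 := one_le_firstCol (hT.1 ⟨0, hn⟩)
    simp only [zero_add] at h1
    omega
  simp [proportionBelow, this]

/-! ### Inequalities for Stirling numbers from small blocks -/

theorem stirlingSecond_pos : ∀ {m y : ℕ}, 1 ≤ y → y ≤ m → 0 < Nat.stirlingSecond m y
  | 0, y, h1, h2 => by omega
  | m + 1, 0, h1, h2 => by omega
  | m + 1, y + 1, h1, h2 => by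
    rw [Nat.stirlingSecond_succ_succ]
    rcases Nat.eq_or_lt_of_le h2 with h | h
    · rw [← Nat.succ_injective h, Nat.stirlingSecond_self]
      omega
    · have := stirlingSecond_pos (m := m) h1 (by omega)
      positivity

/-- In a partition of `m + 2` columns into `y + 1` blocks, the blocks of size one or two are at
most `y + 1` in number; this is the inequality between the averages. -/
theorem singletons_add_doubletons_le : ∀ m y : ℕ,
    (m + 2) * Nat.stirlingSecond (m + 1) y + (m + 2).choose 2 * Nat.stirlingSecond m y ≤
      (y + 1) * Nat.stirlingSecond (m + 2) (y + 1)
  | 0, 0 => by decide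
  | 0, 1 => by decide
  | 0, y + 2 => by
    rw [Nat.stirlingSecond_eq_zero_of_lt (by omega : 0 + 1 < y + 2),
      Nat.stirlingSecond_eq_zero_of_lt (by omega : 0 < y + 2)]
    simp
  | m + 1, 0 => by simp
  | m + 1, y + 1 => by
    have h1 := singletons_add_doubletons_le m (y + 1)
    have h2 := singletons_add_doubletons_le m y
    have hc : (m + 3).choose 2 = (m + 2) + (m + 2).choose 2 := by
      rw [Nat.choose_succ_succ' (m + 2) 1, Nat.choose_one_right]
    have e1 : Nat.stirlingSecond (m + 3) (y + 2) = (y + 2) * Nat.stirlingSecond (m + 2) (y + 2) +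
      Nat.stirlingSecond (m + 2) (y + 1) := Nat.stirlingSecond_succ_succ _ _
    have e2 : Nat.stirlingSecond (m + 2) (y + 1) = (y + 1) * Nat.stirlingSecond (m + 1) (y + 1) +
      Nat.stirlingSecond (m + 1) y := Nat.stirlingSecond_succ_succ _ _
    have e3 : Nat.stirlingSecond (m + 1) (y + 1) = (y + 1) * Nat.stirlingSecond m (y + 1) +
      Nat.stirlingSecond m y := Nat.stirlingSecond_succ_succ _ _
    calc (m + 3) * Nat.stirlingSecond (m + 2) (y + 1) +
          (m + 3).choose 2 * Nat.stirlingSecond (m + 1) (y + 1)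
        = Nat.stirlingSecond (m + 2) (y + 1) +
          (m + 2) * ((y + 1) * Nat.stirlingSecond (m + 1) (y + 1) + Nat.stirlingSecond (m + 1) y) +
          (m + 2) * Nat.stirlingSecond (m + 1) (y + 1) +
          (m + 2).choose 2 *
            ((y + 1) * Nat.stirlingSecond m (y + 1) + Nat.stirlingSecond m y) := by
          rw [hc, ← e2, ← e3]; ring
      _ = Nat.stirlingSecond (m + 2) (y + 1) +
          (y + 1) * ((m + 2) * Nat.stirlingSecond (m + 1) (y + 1) +
            (m + 2).choose 2 * Nat.stirlingSecond m (y + 1)) +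
          ((m + 2) * Nat.stirlingSecond (m + 1) y + (m + 2).choose 2 * Nat.stirlingSecond m y) +
          (m + 2) * Nat.stirlingSecond (m + 1) (y + 1) := by ring
      _ ≤ Nat.stirlingSecond (m + 2) (y + 1) +
          (y + 1) * ((y + 2) * Nat.stirlingSecond (m + 2) (y + 2)) +
          ((y + 1) * Nat.stirlingSecond (m + 2) (y + 1)) +
          (y + 2) * Nat.stirlingSecond (m + 2) (y + 2) := by
          have h3 := (Nat.le_add_right _ _).trans h1
          gcongr
      _ = (y + 2) * Nat.stirlingSecond (m + 3) (y + 2) := by rw [e1]; ring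

theorem succ_mul_stirlingSecond_le (m y : ℕ) :
    (m + 1) * Nat.stirlingSecond m y ≤ (y + 1) * Nat.stirlingSecond (m + 1) (y + 1) := by
  cases m with
  | zero =>
    cases y with
    | zero => simp [Nat.stirlingSecond_self]
    | succ y => simp
  | succ m => exact (Nat.le_add_right _ _).trans (singletons_add_doubletons_le m y)

/-! ### Log-concavity and weak log-convexity in the degree -/

/-- The complete homogeneous symmetric function of degree `d` in `1, …, y`. -/
noncomputable def hsum (y d : ℕ) : ℝ := Nat.stirlingSecond (y + d) y

theorem hsum_zero (y : ℕ) : hsum y 0 = 1 := by simp [hsum, Nat.stirlingSecond_self]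

theorem hsum_succ (y d : ℕ) : hsum (y + 1) (d + 1) = hsum y (d + 1) + (y + 1) * hsum (y + 1) d := by
  have : y + 1 + (d + 1) = (y + 1 + d) + 1 := by ring
  simp only [hsum]
  rw [this, Nat.stirlingSecond_succ_succ, show y + 1 + d = y + (d + 1) by ring]
  push_cast
  ring

theorem hsum_one (d : ℕ) : hsum 1 d = 1 := by
  simp [hsum, add_comm 1 d, Nat.stirlingSecond_one_right]

theorem hsum_pos (y d : ℕ) : 0 < hsum (y + 1) d :=
  Nat.cast_pos.2 (stirlingSecond_pos (by omega) (by omega))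

theorem hsum_nonneg (y d : ℕ) : 0 ≤ hsum y d := Nat.cast_nonneg _

theorem hsum_logConcave : ∀ y d : ℕ,
    hsum (y + 1) (d + 2) * hsum (y + 1) d ≤ hsum (y + 1) (d + 1) ^ 2
  | 0, d => by simp [hsum_one]
  | y + 1, d => by
    have ih := hsum_logConcave y
    -- Log-concavity passes to one more variable through this mixed inequality, which compares sums
    -- in `y + 1` and in `y + 2` variables.
    have aux : ∀ d, hsum (y + 1) (d + 2) * hsum (y + 2) d ≤
        hsum (y + 1) (d + 1) * hsum (y + 2) (d + 1) := by
      intro d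
      induction d with
      | zero =>
        have h := ih 0
        have h1 := hsum_succ (y + 1) 0
        rw [hsum_zero] at h h1 ⊢
        have h2 := hsum_pos y 1
        have h3 : 0 ≤ hsum (y + 1) 1 * ((((y + 1 : ℕ) : ℝ)) + 1) := by positivity
        rw [zero_add] at h h1 ⊢
        rw [h1]
        nlinarith
      | succ d ihd =>
        have p1 := hsum_pos y (d + 1)
        have p2 := hsum_pos y (d + 2)
        have p4 := hsum_pos (y + 1) d
        have key : hsum (y + 1) (d + 3) * hsum (y + 2) d ≤
            hsum (y + 1) (d + 2) * hsum (y + 2) (d + 1) := by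
          refine le_of_mul_le_mul_left ?_ p1
          calc hsum (y + 1) (d + 1) * (hsum (y + 1) (d + 3) * hsum (y + 2) d)
              = hsum (y + 1) (d + 3) * hsum (y + 1) (d + 1) * hsum (y + 2) d := by ring
            _ ≤ hsum (y + 1) (d + 2) ^ 2 * hsum (y + 2) d := by gcongr; exact ih (d + 1)
            _ = hsum (y + 1) (d + 2) * (hsum (y + 1) (d + 2) * hsum (y + 2) d) := by ring
            _ ≤ hsum (y + 1) (d + 2) * (hsum (y + 1) (d + 1) * hsum (y + 2) (d + 1)) := by gcongr
            _ = _ := by ring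
        calc hsum (y + 1) (d + 3) * hsum (y + 2) (d + 1)
            = hsum (y + 1) (d + 3) * hsum (y + 1) (d + 1) +
              ((y + 1 : ℕ) + 1) * (hsum (y + 1) (d + 3) * hsum (y + 2) d) := by
              rw [hsum_succ (y + 1) d]; ring
          _ ≤ hsum (y + 1) (d + 2) ^ 2 +
              ((y + 1 : ℕ) + 1) * (hsum (y + 1) (d + 2) * hsum (y + 2) (d + 1)) := by
              gcongr
              exact ih (d + 1)
          _ = hsum (y + 1) (d + 2) * hsum (y + 2) (d + 2) := by
              rw [hsum_succ (y + 1) (d + 1)]; ring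
    calc hsum (y + 2) (d + 2) * hsum (y + 2) d
        = hsum (y + 1) (d + 2) * hsum (y + 2) d +
          ((y + 1 : ℕ) + 1) * hsum (y + 2) (d + 1) * hsum (y + 2) d := by
          rw [hsum_succ (y + 1) (d + 1)]; ring
      _ ≤ hsum (y + 1) (d + 1) * hsum (y + 2) (d + 1) +
          ((y + 1 : ℕ) + 1) * hsum (y + 2) (d + 1) * hsum (y + 2) d := by
          gcongr ?_ + _
          exact aux d
      _ = (hsum (y + 1) (d + 1) + ((y + 1 : ℕ) + 1) * hsum (y + 2) d) * hsum (y + 2) (d + 1) := by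
          ring
      _ = hsum (y + 2) (d + 1) ^ 2 := by rw [← hsum_succ (y + 1) d]; ring

theorem hsum_mul_le_mul (y : ℕ) {j d : ℕ} (h : j ≤ d) :
    hsum (y + 1) j * hsum (y + 1) (d + 1) ≤ hsum (y + 1) (j + 1) * hsum (y + 1) d := by
  induction d, h using Nat.le_induction with
  | base => exact (mul_comm _ _).le
  | succ d _ ih =>
    have p := hsum_pos y
    refine le_of_mul_le_mul_left ?_ (p d)
    calc hsum (y + 1) d * (hsum (y + 1) j * hsum (y + 1) (d + 2))
        = hsum (y + 1) j * (hsum (y + 1) (d + 2) * hsum (y + 1) d) := by ring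
      _ ≤ hsum (y + 1) j * hsum (y + 1) (d + 1) ^ 2 :=
          mul_le_mul_of_nonneg_left (hsum_logConcave y d) (p j).le
      _ = hsum (y + 1) j * hsum (y + 1) (d + 1) * hsum (y + 1) (d + 1) := by ring
      _ ≤ hsum (y + 1) (j + 1) * hsum (y + 1) d * hsum (y + 1) (d + 1) :=
          mul_le_mul_of_nonneg_right ih (p _).le
      _ = _ := by ring

/-- Newton's identity between complete homogeneous functions and power sums of `1, …, y`. -/
theorem hsum_newton : ∀ y d : ℕ, ((d : ℝ) + 1) * hsum y (d + 1) =
    ∑ i ∈ Finset.range (d + 1), (∑ x ∈ Finset.range y, ((x : ℝ) + 1) ^ (i + 1)) * hsum y (d - i)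
  | 0, d => by simp [hsum]
  | y + 1, d => by
    have ih := hsum_newton y
    set q : ℕ → ℝ := fun i => ∑ x ∈ Finset.range y, ((x : ℝ) + 1) ^ i with hq
    simp only [Finset.sum_range_succ _ y, add_mul, Finset.sum_add_distrib]
    induction d with
    | zero =>
      have := ih 0
      simp only [zero_add, Finset.sum_range_one, hsum_zero, Nat.cast_zero, Nat.sub_zero] at this ⊢
      rw [← zero_add 1, hsum_succ, hsum_zero]
      simp only [zero_add]
      linarith
    | succ d ihd =>
      have hG : ∑ i ∈ Finset.range (d + 2), ((y : ℝ) + 1) ^ (i + 1) * hsum (y + 1) (d + 1 - i) =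
          (y + 1) * ∑ i ∈ Finset.range (d + 1), ((y : ℝ) + 1) ^ (i + 1) * hsum (y + 1) (d - i) +
          (y + 1) * hsum (y + 1) (d + 1) := by
        rw [Finset.sum_range_succ', Finset.mul_sum]
        simp only [Nat.add_sub_add_right, zero_add, pow_one, Nat.sub_zero]
        congr 1
        exact Finset.sum_congr rfl fun i _ => by ring
      have hQ : ∑ i ∈ Finset.range (d + 2), q (i + 1) * hsum (y + 1) (d + 1 - i) =
          ∑ i ∈ Finset.range (d + 2), q (i + 1) * hsum y (d + 1 - i) +
          (y + 1) * ∑ i ∈ Finset.range (d + 1), q (i + 1) * hsum (y + 1) (d - i) := by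
        rw [Finset.sum_range_succ, Finset.sum_range_succ _ (d + 1), Finset.mul_sum]
        simp only [Nat.sub_self, hsum_zero]
        rw [add_right_comm _ (q (d + 1 + 1) * 1), ← Finset.sum_add_distrib]
        congr 1
        refine Finset.sum_congr rfl fun i hi => ?_
        rw [Finset.mem_range] at hi
        rw [show d + 1 - i = (d - i) + 1 by omega, hsum_succ]
        ring
      have h1 := ih (d + 1)
      push_cast at h1 ⊢
      rw [hQ, hG, ← h1, hsum_succ]
      linear_combination (y + 1 : ℝ) * ihd

/-- A partial converse to log-concavity. Expand `(d + 1) h_{d+1}` by Newton's identity, shift each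
term with `hsum_mul_le_mul`, and recognise the expansion of `(d + 2) h_{d+2}` without its last,
nonnegative term. -/
theorem hsum_logConvex (y d : ℕ) : ((d : ℝ) + 1) * hsum (y + 1) (d + 1) ^ 2 ≤
    ((d : ℝ) + 2) * (hsum (y + 1) (d + 2) * hsum (y + 1) d) := by
  have h1 := hsum_newton (y + 1) d
  have h2 := hsum_newton (y + 1) (d + 1)
  have hP : ∀ i : ℕ, 0 ≤ ∑ x ∈ Finset.range (y + 1), ((x : ℝ) + 1) ^ i := fun i =>
    Finset.sum_nonneg fun x _ => by positivity
  calc ((d : ℝ) + 1) * hsum (y + 1) (d + 1) ^ 2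
      = (((d : ℝ) + 1) * hsum (y + 1) (d + 1)) * hsum (y + 1) (d + 1) := by ring
    _ = ∑ i ∈ Finset.range (d + 1), (∑ x ∈ Finset.range (y + 1), ((x : ℝ) + 1) ^ (i + 1)) *
          (hsum (y + 1) (d - i) * hsum (y + 1) (d + 1)) := by
        rw [h1, Finset.sum_mul]
        exact Finset.sum_congr rfl fun i _ => by ring
    _ ≤ ∑ i ∈ Finset.range (d + 1), (∑ x ∈ Finset.range (y + 1), ((x : ℝ) + 1) ^ (i + 1)) *
          (hsum (y + 1) (d + 1 - i) * hsum (y + 1) d) := by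
        refine Finset.sum_le_sum fun i hi => mul_le_mul_of_nonneg_left ?_ (hP _)
        rw [Finset.mem_range] at hi
        rw [show d + 1 - i = (d - i) + 1 by omega]
        exact hsum_mul_le_mul y (Nat.sub_le d i)
    _ ≤ ∑ i ∈ Finset.range (d + 2), (∑ x ∈ Finset.range (y + 1), ((x : ℝ) + 1) ^ (i + 1)) *
          (hsum (y + 1) (d + 1 - i) * hsum (y + 1) d) := by
        rw [Finset.sum_range_succ _ (d + 1)]
        exact le_add_of_nonneg_right (mul_nonneg (hP _)
          (mul_nonneg (hsum_nonneg _ _) (hsum_nonneg _ _)))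
    _ = (((d : ℝ) + 2) * hsum (y + 1) (d + 2)) * hsum (y + 1) d := by
        have : ((d + 1 : ℕ) : ℝ) + 1 = (d : ℝ) + 2 := by push_cast; ring
        rw [← this, h2, Finset.sum_mul]
        exact Finset.sum_congr rfl fun i _ => by ring
    _ = _ := by ring

/-! ### Transition probabilities of the backward walk -/

/-- The probability that the last column of a uniform tableau of size `(m + 1) × (y + 1)` opens
a new row. -/
noncomputable def newProb (m y : ℕ) : ℝ :=
  (Nat.stirlingSecond m y : ℝ) / Nat.stirlingSecond (m + 1) (y + 1)

theorem newProb_nonneg (m y : ℕ) : 0 ≤ newProb m y := by unfold newProb; positivity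

theorem one_sub_newProb {m y : ℕ} (h : y ≤ m) : 1 - newProb m y =
    (y + 1) * Nat.stirlingSecond m (y + 1) / Nat.stirlingSecond (m + 1) (y + 1) := by
  have hp : (0 : ℝ) < Nat.stirlingSecond (m + 1) (y + 1) :=
    Nat.cast_pos.2 (stirlingSecond_pos (by omega) (by omega))
  rw [newProb, eq_div_iff hp.ne', sub_mul, div_mul_cancel₀ _ hp.ne', Nat.stirlingSecond_succ_succ]
  push_cast
  ring

theorem newProb_le_one {m y : ℕ} (h : y ≤ m) : newProb m y ≤ 1 := by
  have h1 := one_sub_newProb h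
  have : (0 : ℝ) ≤ (y + 1) * Nat.stirlingSecond m (y + 1) / Nat.stirlingSecond (m + 1) (y + 1) := by
    positivity
  linarith

theorem newProb_le_div {m y : ℕ} (h : y ≤ m) : newProb m y ≤ ((y : ℝ) + 1) / (m + 1) := by
  have hp : (0 : ℝ) < Nat.stirlingSecond (m + 1) (y + 1) :=
    Nat.cast_pos.2 (stirlingSecond_pos (by omega) (by omega))
  rw [newProb, div_le_div_iff₀ hp (by positivity)]
  have := succ_mul_stirlingSecond_le m y
  rw [mul_comm]
  exact_mod_cast this

/-- For `m` near `k y`, `newProb_le_div` gives only about `1 / k`, which is zero drift. Counting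
blocks of size two as well as singletons improves this to about `2 / (k (k + 1))`, strictly below `1
/ k` for `k ≥ 2`. -/
theorem newProb_mul_le {m y : ℕ} (h : y ≤ m) :
    newProb m y * ((m : ℝ) + y + 2) ≤ 2 * ((y : ℝ) + 1) ^ 2 / (m + 1) := by
  have hm1 : (0 : ℝ) < (m : ℝ) + 1 := by positivity
  rw [le_div_iff₀ hm1]
  rcases Nat.eq_zero_or_pos y with rfl | hy
  · cases m with
    | zero => simp [newProb, Nat.stirlingSecond_self]
    | succ m => simp [newProb]
  obtain ⟨m, rfl⟩ : ∃ m', m = m' + 1 := ⟨m - 1, by omega⟩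
  obtain ⟨y, rfl⟩ : ∃ y', y = y' + 1 := ⟨y - 1, by omega⟩
  have hp : (0 : ℝ) < Nat.stirlingSecond (m + 2) (y + 2) :=
    Nat.cast_pos.2 (stirlingSecond_pos (by omega) (by omega))
  have hp' : (0 : ℝ) < Nat.stirlingSecond (m + 1) (y + 1) :=
    Nat.cast_pos.2 (stirlingSecond_pos (by omega) (by omega))
  have h1 : ((m : ℝ) + 2) * Nat.stirlingSecond (m + 1) (y + 1) +
      ((m : ℝ) + 2) * (m + 1) / 2 * Nat.stirlingSecond m (y + 1) ≤
      ((y : ℝ) + 2) * Nat.stirlingSecond (m + 2) (y + 2) := by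
    have h0 := singletons_add_doubletons_le m (y + 1)
    have h2 := (Nat.cast_le (α := ℝ)).2 h0
    push_cast [Nat.cast_choose_two] at h2
    nlinarith
  have h2 := succ_mul_stirlingSecond_le m y
  have h2' : ((m : ℝ) + 1) * Nat.stirlingSecond m y ≤
      (y + 1) * Nat.stirlingSecond (m + 1) (y + 1) := by exact_mod_cast h2
  have h3 : (Nat.stirlingSecond (m + 1) (y + 1) : ℝ) =
      (y + 1) * Nat.stirlingSecond m (y + 1) + Nat.stirlingSecond m y := by
    rw [Nat.stirlingSecond_succ_succ]; push_cast; ring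
  -- The singleton bound one column earlier turns the doubleton term of `h1` into a multiple of the
  -- singleton term.
  have h4 : ((m : ℝ) - y) * Nat.stirlingSecond (m + 1) (y + 1) ≤
      (m + 1) * ((y + 1) * Nat.stirlingSecond m (y + 1)) := by nlinarith
  have h5 : ((m : ℝ) + 2) * Nat.stirlingSecond (m + 1) (y + 1) * (2 * (y + 1) + (m - y)) ≤
      2 * (y + 1) * (((y : ℝ) + 2) * Nat.stirlingSecond (m + 2) (y + 2)) := by
    have hy0 : (0 : ℝ) ≤ 2 * (y + 1) := by positivity
    have h6 := mul_le_mul_of_nonneg_left h1 hy0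
    have h7 := mul_le_mul_of_nonneg_left h4 (by positivity : (0 : ℝ) ≤ (m : ℝ) + 2)
    nlinarith
  have hn : newProb (m + 1) (y + 1) * Nat.stirlingSecond (m + 2) (y + 2) =
      Nat.stirlingSecond (m + 1) (y + 1) := div_mul_cancel₀ _ hp.ne'
  refine le_of_mul_le_mul_right ?_ hp
  push_cast
  have h8 : newProb (m + 1) (y + 1) * (m + 1 + (y + 1) + 2) * (m + 1 + 1) *
      Nat.stirlingSecond (m + 2) (y + 2) =
      (m + 2) * Nat.stirlingSecond (m + 1) (y + 1) * (2 * (y + 1) + (m - y)) +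
        2 * ((m + 2) * Nat.stirlingSecond (m + 1) (y + 1)) := by
    rw [← hn]; ring
  have h9 : ((m : ℝ) + 2) * Nat.stirlingSecond (m + 1) (y + 1) ≤
      (y + 2) * Nat.stirlingSecond (m + 2) (y + 2) := by
    have := succ_mul_stirlingSecond_le (m + 1) (y + 1)
    exact_mod_cast this
  rw [h8]
  nlinarith

/-- With `e = m - y - 1`, the complement of `newProb m y` is `(y + 1) h_e / h_{e+1}`. Log-concavity
makes it nondecreasing in `m`, and weak log-convexity limits its growth to a factor `(e + 2) / (e +
1)`. -/
theorem abs_newProb_sub_succ_le {m y : ℕ} (h : y < m) :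
    |newProb m y - newProb (m + 1) y| ≤ 1 / ((m : ℝ) - y) := by
  obtain ⟨e, rfl⟩ : ∃ e, m = y + 1 + e := ⟨m - (y + 1), by omega⟩
  have p := hsum_pos y
  have e1 : 1 - newProb (y + 1 + e) y = (y + 1) * hsum (y + 1) e / hsum (y + 1) (e + 1) :=
    one_sub_newProb (by omega)
  have e2 : 1 - newProb (y + 1 + e + 1) y =
      (y + 1) * hsum (y + 1) (e + 1) / hsum (y + 1) (e + 2) := one_sub_newProb (by omega)
  have h1 := hsum_logConcave y e
  have h2 := hsum_logConvex y e
  have h3 : (y + 1) * hsum (y + 1) e / hsum (y + 1) (e + 1) ≤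
      (y + 1) * hsum (y + 1) (e + 1) / hsum (y + 1) (e + 2) := by
    rw [div_le_div_iff₀ (p _) (p _)]
    have := mul_le_mul_of_nonneg_left h1 (by positivity : (0 : ℝ) ≤ (y : ℝ) + 1)
    nlinarith
  have h4 : (e + 1) * ((y + 1) * hsum (y + 1) (e + 1) / hsum (y + 1) (e + 2)) ≤
      (e + 2) * ((y + 1) * hsum (y + 1) e / hsum (y + 1) (e + 1)) := by
    rw [← mul_div_assoc, ← mul_div_assoc, div_le_div_iff₀ (p _) (p _)]
    have := mul_le_mul_of_nonneg_left h2 (by positivity : (0 : ℝ) ≤ (y : ℝ) + 1)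
    nlinarith
  have h5 := newProb_nonneg (y + 1 + e) y
  rw [← e1, ← e2] at h3 h4
  have he : (((y + 1 + e : ℕ) : ℝ) - y) = e + 1 := by push_cast; ring
  rw [he, abs_of_nonneg (by linarith), le_div_iff₀ (by positivity)]
  nlinarith

theorem abs_newProb_sub_add_le {m y : ℕ} (h : y < m) (b : ℕ) :
    |newProb m y - newProb (m + b) y| ≤ b / ((m : ℝ) - y) := by
  have hpos : (0 : ℝ) < (m : ℝ) - y := by
    have : (y : ℝ) < m := by exact_mod_cast h
    linarith
  induction b with
  | zero => simp
  | succ b ih =>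
    have h1 := abs_newProb_sub_succ_le (m := m + b) (y := y) (by omega)
    have h2 : 1 / (((m + b : ℕ) : ℝ) - y) ≤ 1 / ((m : ℝ) - y) := by
      apply one_div_le_one_div_of_le hpos
      push_cast
      have : (0 : ℝ) ≤ b := by positivity
      linarith
    calc |newProb m y - newProb (m + (b + 1)) y|
        ≤ |newProb m y - newProb (m + b) y| + |newProb (m + b) y - newProb (m + b + 1) y| :=
          abs_sub_le _ _ _
      _ ≤ b / ((m : ℝ) - y) + 1 / ((m : ℝ) - y) := add_le_add ih (h1.trans h2)
      _ = _ := by push_cast; ring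

/-! ### The backward walk, superharmonic bounds and comparison of two walks -/

/-- The proportion of the tableaux of size `m × y` counted by `walkCount A m y`. -/
noncomputable def walkProb (A : ℕ → ℕ → Prop) (m y : ℕ) : ℝ :=
  (walkCount A m y : ℝ) / Nat.stirlingSecond m y

theorem walkProb_nonneg (A : ℕ → ℕ → Prop) (m y : ℕ) : 0 ≤ walkProb A m y := by
  unfold walkProb; positivity

theorem walkProb_le_one (A : ℕ → ℕ → Prop) (m y : ℕ) : walkProb A m y ≤ 1 :=
  div_le_one_of_le₀ (Nat.cast_le.2 (walkCount_le A m y)) (Nat.cast_nonneg _)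

theorem walkProb_of_lt (A : ℕ → ℕ → Prop) {m y : ℕ} (h : m < y) : walkProb A m y = 0 := by
  simp [walkProb, Nat.stirlingSecond_eq_zero_of_lt h]

theorem walkProb_mul (A : ℕ → ℕ → Prop) (m y : ℕ) :
    walkProb A m y * Nat.stirlingSecond m y = walkCount A m y := by
  rcases Nat.eq_zero_or_pos (Nat.stirlingSecond m y) with h | h
  · have := walkCount_le A m y
    rw [h] at this ⊢
    simp [Nat.le_zero.1 this]
  · exact div_mul_cancel₀ _ (Nat.cast_pos.2 h).ne'

open Classical in
/-- Conditioning on the last column. -/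
theorem walkProb_succ (A : ℕ → ℕ → Prop) {m y : ℕ} (h : y ≤ m) :
    walkProb A (m + 1) (y + 1) = newProb m y * (if A (m + 1) (y + 1) then walkProb A m y else 0) +
      (1 - newProb m y) * walkProb A m (y + 1) := by
  have hp : (0 : ℝ) < Nat.stirlingSecond (m + 1) (y + 1) :=
    Nat.cast_pos.2 (stirlingSecond_pos (by omega) (by omega))
  have h1 := walkProb_mul A m y
  have h2 := walkProb_mul A m (y + 1)
  rw [one_sub_newProb h, newProb, walkProb, walkCount, div_eq_iff hp.ne']
  split_ifs
  · push_cast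
    field_simp
    linear_combination -h1 - (y + 1) * h2
  · push_cast
    field_simp
    linear_combination -((y : ℝ) + 1) * h2

theorem walkCount_eq_of_forall (A : ℕ → ℕ → Prop) : ∀ m y : ℕ, (∀ x ≤ m, ∀ z, A x z) →
    walkCount A m y = Nat.stirlingSecond m y
  | 0, 0, _ => by simp [walkCount]
  | 0, y + 1, _ => by simp [walkCount]
  | m + 1, 0, _ => by simp [walkCount]
  | m + 1, y + 1, h => by
    have h' : ∀ x ≤ m, ∀ z, A x z := fun x hx => h x (hx.trans (Nat.le_succ m))
    simp [walkCount, Nat.stirlingSecond_succ_succ, walkCount_eq_of_forall A m y h',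
      walkCount_eq_of_forall A m (y + 1) h', h (m + 1) le_rfl]

theorem walkProb_eq_one {A : ℕ → ℕ → Prop} {m y : ℕ} (hy : 1 ≤ y) (hym : y ≤ m)
    (h : ∀ x ≤ m, ∀ z, A x z) : walkProb A m y = 1 := by
  rw [walkProb, walkCount_eq_of_forall A m y h,
    div_self (Nat.cast_pos.2 (stirlingSecond_pos hy hym)).ne']

/-- A nonnegative superharmonic function that is at least `1` where `E` holds and `A` fails bounds
the probability that the walk satisfies `E` throughout but not `A`. -/
theorem walkProb_sub_le {E A : ℕ → ℕ → Prop} {M n : ℕ} {Φ : ℕ → ℕ → ℝ}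
    (hΦ : ∀ m y, 0 ≤ Φ m y)
    (hstep : ∀ m y, y ≤ m → m + 1 ≤ M → y + 1 ≤ n →
      newProb m y * Φ m y + (1 - newProb m y) * Φ m (y + 1) ≤ Φ (m + 1) (y + 1))
    (hviol : ∀ m y, y ≤ m → m + 1 ≤ M → y + 1 ≤ n → n + m ≤ M + y →
      E (m + 1) (y + 1) → ¬ A (m + 1) (y + 1) → 1 ≤ Φ (m + 1) (y + 1)) :
    -- The condition `n + m ≤ M + y` says that `(m, y)` is reachable backwards from `(M, n)`: at
    -- most one row is lost per column.
    ∀ m y, m ≤ M → y ≤ n → n + m ≤ M + y → walkProb E m y - walkProb A m y ≤ Φ m y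
  | 0, 0, _, _, _ => by simpa [walkProb, walkCount] using hΦ 0 0
  | 0, y + 1, _, _, _ => by simpa [walkProb, walkCount] using hΦ 0 (y + 1)
  | m + 1, 0, _, _, _ => by simpa [walkProb, walkCount] using hΦ (m + 1) 0
  | m + 1, y + 1, hm, hy, hr => by
    classical
    rcases Nat.lt_or_ge m y with h | h
    · rw [walkProb_of_lt E (by omega), walkProb_of_lt A (by omega), sub_self]
      exact hΦ _ _
    · by_cases hEA : E (m + 1) (y + 1) ∧ ¬ A (m + 1) (y + 1)
      · have h1 := hviol m y h hm hy (by omega) hEA.1 hEA.2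
        have h2 := walkProb_le_one E (m + 1) (y + 1)
        have h3 := walkProb_nonneg A (m + 1) (y + 1)
        linarith
      · have ih1 := walkProb_sub_le hΦ hstep hviol m y (by omega) (by omega) (by omega)
        have ih2 := walkProb_sub_le hΦ hstep hviol m (y + 1) (by omega) hy (by omega)
        have p0 := newProb_nonneg m y
        have p1 := newProb_le_one h
        refine le_trans ?_ (hstep m y h hm hy)
        rw [walkProb_succ E h, walkProb_succ A h]
        have h4 : (if E (m + 1) (y + 1) then walkProb E m y else 0) -
            (if A (m + 1) (y + 1) then walkProb A m y else 0) ≤ Φ m y := by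
          have := hΦ m y
          have := walkProb_nonneg A m y
          split_ifs with hE hA hA
          · exact ih1
          · exact absurd ⟨hE, hA⟩ hEA
          · linarith
          · linarith
        have h5 := mul_le_mul_of_nonneg_left h4 p0
        have h6 := mul_le_mul_of_nonneg_left ih2 (sub_nonneg.2 p1)
        linarith

/-- Two walks whose last `J` columns obey the same rules, started from `M` and `M + B` columns,
have almost the same probability of success. -/
theorem abs_walkProb_sub_le {E E' : ℕ → ℕ → Prop} {m n B J : ℕ} (hJ : J < n) (hnm : n ≤ m)
    (hE : ∀ x ≤ m, ∀ z, E x z) (hE' : ∀ x ≤ m + B, ∀ z, E' x z)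
    (hEE' : ∀ i < J, ∀ y, E (m + i + 1) y ↔ E' (m + B + i + 1) y) :
    ∀ i y, i ≤ J → y ≤ n → n + i ≤ y + J →
      |walkProb E (m + i) y - walkProb E' (m + B + i) y| ≤ i * (B / ((m : ℝ) + 1 - n))
  | 0, y, _, hy, hr => by
    rw [add_zero, add_zero, walkProb_eq_one (by omega) (by omega) hE,
      walkProb_eq_one (by omega) (by omega) hE']
    simp
  | i + 1, 0, hi, hy, hr => by omega
  | i + 1, y + 1, hi, hy, hr => by
    classical
    have ih1 := abs_walkProb_sub_le hJ hnm hE hE' hEE' i y (by omega) (by omega) (by omega)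
    have ih2 := abs_walkProb_sub_le hJ hnm hE hE' hEE' i (y + 1) (by omega) hy (by omega)
    set δ : ℝ := B / ((m : ℝ) + 1 - n) with hδ
    have hmn : (n : ℝ) ≤ m := by exact_mod_cast hnm
    have hyn : (y : ℝ) + 1 ≤ n := by exact_mod_cast hy
    have hδ0 : 0 ≤ δ := div_nonneg (Nat.cast_nonneg _) (by linarith)
    have hpp : |newProb (m + i) y - newProb (m + B + i) y| ≤ δ := by
      rw [show m + B + i = m + i + B by ring]
      refine (abs_newProb_sub_add_le (by omega) B).trans ?_
      refine div_le_div_of_nonneg_left (Nat.cast_nonneg _) (by linarith) ?_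
      push_cast
      have : (0 : ℝ) ≤ i := Nat.cast_nonneg _
      linarith
    have p0 := newProb_nonneg (m + i) y
    have p1 := newProb_le_one (m := m + i) (y := y) (by omega)
    have e1 : walkProb E (m + (i + 1)) (y + 1) = _ :=
      walkProb_succ E (m := m + i) (y := y) (by omega)
    have e2 : walkProb E' (m + B + (i + 1)) (y + 1) = _ :=
      walkProb_succ E' (m := m + B + i) (y := y) (by omega)
    rw [e1, e2]
    simp only [hEE' i (by omega) (y + 1)]
    set a := newProb (m + i) y
    set a' := newProb (m + B + i) y
    set u := walkProb E (m + i) (y + 1)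
    set u' := walkProb E' (m + B + i) (y + 1) with hu'
    set v : ℝ := if E' (m + B + i + 1) (y + 1) then walkProb E (m + i) y else 0 with hv
    set v' : ℝ := if E' (m + B + i + 1) (y + 1) then walkProb E' (m + B + i) y else 0 with hv'
    have hv1 : |v - v'| ≤ i * δ := by
      rw [hv, hv']
      split_ifs
      · exact ih1
      · simpa using mul_nonneg (Nat.cast_nonneg i) hδ0
    have hv0 : |v' - u'| ≤ 1 := by
      have h1 := walkProb_nonneg E' (m + B + i) (y + 1)
      have h2 := walkProb_le_one E' (m + B + i) (y + 1)
      have h3 := walkProb_nonneg E' (m + B + i) y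
      have h4 := walkProb_le_one E' (m + B + i) y
      rw [abs_le, hv', hu']
      split_ifs <;> constructor <;> linarith
    -- Each step averages the earlier errors and adds at most `|a - a'| ≤ δ`.
    have e3 : a * v + (1 - a) * u - (a' * v' + (1 - a') * u') =
        a * (v - v') + (1 - a) * (u - u') + (a - a') * (v' - u') := by ring
    rw [e3]
    calc |a * (v - v') + (1 - a) * (u - u') + (a - a') * (v' - u')|
        ≤ |a * (v - v')| + |(1 - a) * (u - u')| + |(a - a') * (v' - u')| := abs_add_three _ _ _
      _ = a * |v - v'| + (1 - a) * |u - u'| + |a - a'| * |v' - u'| := by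
          rw [abs_mul, abs_mul, abs_mul, abs_of_nonneg p0, abs_of_nonneg (sub_nonneg.2 p1)]
      _ ≤ a * (i * δ) + (1 - a) * (i * δ) + δ * 1 := by
          have := sub_nonneg.2 p1
          gcongr
      _ = ((i + 1 : ℕ) : ℝ) * δ := by push_cast; ring

/-- In the last `J` of `M` columns, row `y` opens at least `k (n - y + 1)` columns before
the end. -/
def lastCond (k M n J : ℕ) (x y : ℕ) : Prop :=
  M < x + J → (x : ℤ) ≤ M - k * (n - y + 1)

theorem abs_walkProb_lastCond_sub_le {k M n B J : ℕ} (hJ : J < n) (hM : n + J ≤ M) :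
    |walkProb (lastCond k M n J) M n - walkProb (lastCond k (M + B) n J) (M + B) n| ≤
      J * (B / ((M : ℝ) - J + 1 - n)) := by
  obtain ⟨m, rfl⟩ : ∃ m, M = m + J := ⟨M - J, by omega⟩
  have h := abs_walkProb_sub_le (E := lastCond k (m + J) n J) (E' := lastCond k (m + J + B) n J)
    (m := m) (n := n) (B := B) (J := J) hJ (by omega)
    (fun x hx z h => by omega) (fun x hx z h => by omega)
    (fun i hi y => by
      have h1 : m + J < m + i + 1 + J := by omega
      have h2 : m + J + B < m + B + i + 1 + J := by omega
      simp only [lastCond, h1, h2, true_imp_iff]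
      push_cast
      constructor <;> intro h <;> linarith) J n le_rfl le_rfl le_rfl
  rw [show m + B + J = m + J + B by ring] at h
  simpa using h

/-! ### A superharmonic function for the low rows -/

/-- The probability that the first two columns of a uniform tableau have the same mark. -/
noncomputable def pairProb : ℕ → ℕ → ℝ
  | 0, _ => 0
  | m + 1, y => (Nat.stirlingSecond m y : ℝ) / Nat.stirlingSecond (m + 1) y

theorem pairProb_nonneg : ∀ m y : ℕ, 0 ≤ pairProb m y
  | 0, _ => le_rfl
  | m + 1, y => by unfold pairProb; positivity

/-- This is conditioning of the event on the last column; equality is lost only where a Stirling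
number in a denominator vanishes. -/
theorem newProb_mul_pairProb_le : ∀ m y : ℕ, y ≤ m →
    newProb m y * pairProb m y + (1 - newProb m y) * pairProb m (y + 1) ≤
      pairProb (m + 1) (y + 1)
  | 0, y, _ => by simp [pairProb]
  | m + 1, y, h => by
    have hp : (0 : ℝ) < Nat.stirlingSecond (m + 2) (y + 1) :=
      Nat.cast_pos.2 (stirlingSecond_pos (by omega) (by omega))
    rw [one_sub_newProb h, newProb]
    simp only [pairProb]
    -- For `b = 0` the quotient is read as `0`, so only an inequality survives.
    have key : ∀ a b : ℝ, 0 ≤ a → 0 ≤ b → b * (a / b) ≤ a := fun a b ha hb => by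
      rcases hb.eq_or_lt with rfl | hb
      · simpa using ha
      · rw [mul_div_cancel₀ _ hb.ne']
    have h1 := key (Nat.stirlingSecond m y) (Nat.stirlingSecond (m + 1) y) (by positivity)
      (by positivity)
    have h2 := key (Nat.stirlingSecond m (y + 1)) (Nat.stirlingSecond (m + 1) (y + 1))
      (by positivity) (by positivity)
    have h3 := mul_le_mul_of_nonneg_left h2 (by positivity : (0 : ℝ) ≤ (y : ℝ) + 1)
    rw [div_mul_eq_mul_div, div_mul_eq_mul_div, ← add_div]
    refine div_le_div_of_nonneg_right ?_ hp.le
    have h4 : (Nat.stirlingSecond (m + 1) (y + 1) : ℝ) =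
        (y + 1) * Nat.stirlingSecond m (y + 1) + Nat.stirlingSecond m y := by
      rw [Nat.stirlingSecond_succ_succ]; push_cast; ring
    linarith

theorem pairProb_succ {m y : ℕ} (h : y ≤ m) :
    pairProb (m + 1) (y + 1) = (1 - newProb m y) / (y + 1) := by
  rw [one_sub_newProb h, pairProb]
  field_simp

theorem pairProb_succ_le {m y : ℕ} (h : y ≤ m) :
    pairProb (m + 1) (y + 1) ≤ 1 / ((y : ℝ) + 1) := by
  rw [pairProb_succ h]
  have := newProb_nonneg m y
  gcongr
  linarith

/-- Here `newProb` is at most `2 / 3`, so a mark joins an old row with probability at least `1 / 3`.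
Together with `pairProb_succ_le` this bounds the chance of a violation below row `K` by `3 K / n`.
-/
theorem le_pairProb_succ {m y : ℕ} (h : 3 * (y + 1) ≤ 2 * (m + 1)) :
    1 / (3 * ((y : ℝ) + 1)) ≤ pairProb (m + 1) (y + 1) := by
  have hym : y ≤ m := by omega
  have h1 := newProb_le_div hym
  have h2 : ((y : ℝ) + 1) / (m + 1) ≤ 2 / 3 := by
    rw [div_le_div_iff₀ (by positivity) (by norm_num)]
    have : (3 * (y + 1) : ℝ) ≤ 2 * (m + 1) := by exact_mod_cast h
    linarith
  rw [pairProb_succ hym, one_div, mul_inv, div_eq_mul_inv]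
  gcongr
  linarith

/-! ### Exponential moments in the bulk -/

/-- An exponential moment that contracts when steps up by `k - 1` have probability at most
`5 / (6 k)` and the other steps go down by `1`. -/
theorem exists_exp_contraction {k : ℕ} (hk : 1 ≤ k) : ∃ θ ρ : ℝ, 0 < θ ∧ 0 < ρ ∧ ρ < 1 ∧
    ∀ p : ℝ, p ≤ 5 / (6 * k) →
      p * Real.exp (θ * (k - 1)) + (1 - p) * Real.exp (-θ) ≤ ρ := by
  have hk0 : (0 : ℝ) < k := by exact_mod_cast hk
  have he : Real.exp (1 / 10) ≤ 1.11 := by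
    have h := Real.abs_exp_sub_one_sub_id_le (x := 1 / 10) (by rw [abs_of_pos] <;> norm_num)
    rw [abs_le] at h
    norm_num at h ⊢
    linarith [h.2]
  -- With `θ k = 1 / 10` and `exp (1 / 10) ≤ 1.11`, the gain `0.11 * 5 / (6 k)` falls short of the
  -- loss `1 / (10 k)` by `1 / (120 k)`.
  refine ⟨1 / (10 * k), Real.exp (-(1 / (10 * k))) * (1 + 0.11 * (5 / (6 * k))), by positivity,
    by positivity, ?_, fun p hp => ?_⟩
  · rw [Real.exp_neg, inv_mul_lt_iff₀ (Real.exp_pos _), mul_one]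
    refine lt_of_lt_of_le ?_ (Real.add_one_le_exp _)
    rw [add_comm]
    gcongr
    rw [← sub_pos]
    have : 1 / (10 * (k : ℝ)) - 0.11 * (5 / (6 * k)) = (1 / 120) / k := by
      field_simp
      norm_num
    rw [this]
    positivity
  · have h1 : Real.exp (1 / (10 * k) * (k - 1)) = Real.exp (-(1 / (10 * k))) * Real.exp (1 / 10) := by
      rw [← Real.exp_add]
      congr 1
      field_simp
      ring
    have h1' : (1 : ℝ) ≤ Real.exp (1 / 10) := Real.one_le_exp (by norm_num)
    have h2 : p * (Real.exp (1 / 10) - 1) ≤ 5 / (6 * k) * 0.11 :=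
      mul_le_mul hp (by linarith) (by linarith) (by positivity)
    rw [h1]
    have h3 : p * (Real.exp (-(1 / (10 * k))) * Real.exp (1 / 10)) +
        (1 - p) * Real.exp (-(1 / (10 * k))) =
        Real.exp (-(1 / (10 * k))) * (1 + p * (Real.exp (1 / 10) - 1)) := by ring
    rw [h3]
    refine mul_le_mul_of_nonneg_left ?_ (Real.exp_pos _).le
    linarith

/-- `k` times the number of new rows minus the number of columns, on the way back from
`(M, n)` to `(m, y)`. -/
noncomputable def excess (k M n m y : ℕ) : ℝ := k * ((n : ℝ) - y) - ((M : ℝ) - m)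

/-- The superharmonic function that controls the last columns and the bulk of a tableau. -/
noncomputable def bulkPotential (k M n J : ℕ) (θ ρ K D : ℝ) (m y : ℕ) : ℝ :=
  if K ≤ y then
    Real.exp (θ * k) * (ρ ^ (J - (M - m)) * Real.exp (θ * excess k M n m y) + m * D)
  else 0

theorem bulkPotential_nonneg {k M n J : ℕ} {θ ρ K D : ℝ} (hρ : 0 ≤ ρ) (hD : 0 ≤ D) (m y : ℕ) :
    0 ≤ bulkPotential k M n J θ ρ K D m y := by
  unfold bulkPotential
  split_ifs
  · positivity
  · exact le_rfl

theorem bulkPotential_le {k M n J : ℕ} {θ ρ K D : ℝ} (hρ : 0 ≤ ρ) (hD : 0 ≤ D) (m y : ℕ) :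
    bulkPotential k M n J θ ρ K D m y ≤
      Real.exp (θ * k) * (ρ ^ (J - (M - m)) * Real.exp (θ * excess k M n m y) + m * D) := by
  unfold bulkPotential
  split_ifs
  · exact le_rfl
  · positivity

/-- Excess not far below zero keeps `m` close to or above `k y`. Losing `z / 4` still leaves `m + 1
≥ (7/8) k z` and `m + y + 2 ≥ (11/4) z` with `z = y + 1`, and `newProb_mul_le` yields `64 / (77 k) <
5 / (6 k)`. -/
theorem newProb_le_of_excess {k M n m y : ℕ} {K κ κ' : ℝ} (hk : 2 ≤ k) (hK : K ≤ (y : ℝ) + 1)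
    (hym : y ≤ m) (hex : -κ ≤ excess k M n (m + 1) (y + 1)) (hMn : (k : ℝ) * n - κ' ≤ M) (hκ' : κ + κ' ≤ K / 4) :
    newProb m y ≤ 5 / (6 * k) := by
  have hk2 : (2 : ℝ) ≤ k := by exact_mod_cast hk
  have hex' : (M : ℝ) - k * n + excess k M n (m + 1) (y + 1) =
      (m : ℝ) + 1 - k * (y + 1) := by
    simp only [excess]; push_cast; ring
  have h0 := newProb_nonneg m y
  have h1 := newProb_mul_le hym
  set p := newProb m y
  have hz : (0 : ℝ) < (y : ℝ) + 1 := by positivity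
  set z : ℝ := (y : ℝ) + 1 with hzdef
  have hm : (k : ℝ) * z - z / 4 ≤ m + 1 := by linarith
  have hm1 : 7 / 8 * k * z ≤ (m : ℝ) + 1 := by nlinarith
  have hm2 : 11 / 4 * z ≤ (m : ℝ) + y + 2 := by nlinarith
  have hmpos : (0 : ℝ) < (m : ℝ) + 1 := by positivity
  rw [le_div_iff₀ hmpos] at h1
  have h2 : p * (11 / 4 * z) * (7 / 8 * k * z) ≤ 2 * z ^ 2 := by
    refine le_trans ?_ h1
    gcongr
  have h3 : p * (77 / 32 * k) ≤ 2 := by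
    refine le_of_mul_le_mul_right ?_ (pow_pos hz 2)
    linarith
  rw [le_div_iff₀ (by positivity)]
  nlinarith

/-- While the excess is at least `-κ`, the exponential term contracts by `ρ`. Below `-κ` contraction
may fail, but the exponential is then so small that the budget `D` per column pays for it. Setting
the potential to `0` below row `K` is harmless, since the backward walk never climbs. -/
theorem bulkPotential_step {k M n J : ℕ} {θ ρ K κ κ' : ℝ} (hk : 2 ≤ k) (hθ : 0 < θ) (hρ0 : 0 < ρ)
    (hρ1 : ρ < 1) (hρ : ∀ p : ℝ, p ≤ 5 / (6 * k) →
      p * Real.exp (θ * (k - 1)) + (1 - p) * Real.exp (-θ) ≤ ρ)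
    (hMn : (k : ℝ) * n - κ' ≤ M) (hκ' : κ + κ' ≤ K / 4) {m y : ℕ} (hym : y ≤ m) (hmM : m + 1 ≤ M) :
    newProb m y * bulkPotential k M n J θ ρ K (Real.exp (θ * k) * Real.exp (-(θ * κ))) m y +
      (1 - newProb m y) *
        bulkPotential k M n J θ ρ K (Real.exp (θ * k) * Real.exp (-(θ * κ))) m (y + 1) ≤
      bulkPotential k M n J θ ρ K (Real.exp (θ * k) * Real.exp (-(θ * κ))) (m + 1) (y + 1) := by
  set D := Real.exp (θ * k) * Real.exp (-(θ * κ)) with hD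
  have hD0 : 0 ≤ D := by positivity
  by_cases hK : K ≤ ((y + 1 : ℕ) : ℝ)
  swap
  · have hK' : ¬ K ≤ (y : ℝ) := fun h => hK (h.trans (by push_cast; linarith))
    simp only [bulkPotential, if_neg hK, if_neg hK', mul_zero, add_zero, le_refl]
  have p0 := newProb_nonneg m y
  have p1 := sub_nonneg.2 (newProb_le_one hym)
  have hmain : newProb m y * (ρ ^ (J - (M - m)) * Real.exp (θ * excess k M n m y) + m * D) +
      (1 - newProb m y) *
        (ρ ^ (J - (M - m)) * Real.exp (θ * excess k M n m (y + 1)) + m * D) ≤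
      ρ ^ (J - (M - (m + 1))) * Real.exp (θ * excess k M n (m + 1) (y + 1)) +
        ((m + 1 : ℕ) : ℝ) * D := by
    set W := excess k M n (m + 1) (y + 1) with hW
    have hW1 : excess k M n m y = W + (k - 1) := by
      rw [hW]; simp only [excess]; push_cast; ring
    have hW2 : excess k M n m (y + 1) = W + (-1) := by
      rw [hW]; simp only [excess]; push_cast; ring
    set r := ρ ^ (J - (M - m)) with hr
    have hr0 : 0 ≤ r := by positivity
    have hr1 : r ≤ 1 := pow_le_one₀ hρ0.le hρ1.le
    -- Truncated subtraction stops the exponent at `0` once `J` columns have been read.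
    have hrr : r * ρ ≤ ρ ^ (J - (M - (m + 1))) := by
      rw [hr, ← pow_succ]
      exact pow_le_pow_of_le_one hρ0.le hρ1.le (by omega)
    set g := newProb m y * Real.exp (θ * (k - 1)) + (1 - newProb m y) * Real.exp (-θ) with hg
    have hlhs : newProb m y * (r * Real.exp (θ * excess k M n m y) + m * D) +
        (1 - newProb m y) * (r * Real.exp (θ * excess k M n m (y + 1)) + m * D) =
        r * g * Real.exp (θ * W) + m * D := by
      rw [hW1, hW2, mul_add θ, mul_add θ, Real.exp_add, Real.exp_add, hg, mul_neg_one]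
      ring
    rw [hlhs]
    have hEW := Real.exp_pos (θ * W)
    by_cases hWκ : -κ ≤ W
    · have hgρ : g ≤ ρ := by
        refine hρ _ (newProb_le_of_excess (κ := κ) (κ' := κ') (M := M) (n := n) (K := K) hk
          (by exact_mod_cast hK) hym hWκ hMn hκ')
      calc r * g * Real.exp (θ * W) + m * D
          ≤ r * ρ * Real.exp (θ * W) + m * D := by gcongr
        _ ≤ ρ ^ (J - (M - (m + 1))) * Real.exp (θ * W) + ((m + 1 : ℕ) : ℝ) * D := by
            gcongr
            exact Nat.le_succ m
    · have hk1 : (1 : ℝ) ≤ k := by exact_mod_cast (by omega : 1 ≤ k)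
      have hg1 : g ≤ Real.exp (θ * k) := by
        calc g ≤ newProb m y * Real.exp (θ * k) + (1 - newProb m y) * Real.exp (θ * k) := by
              rw [hg]
              gcongr
              · linarith
              · nlinarith
          _ = _ := by ring
      have hWD : Real.exp (θ * W) ≤ Real.exp (-(θ * κ)) := by
        apply Real.exp_le_exp.2
        nlinarith
      have hg0 : 0 ≤ g := by positivity
      calc r * g * Real.exp (θ * W) + m * D
          ≤ 1 * Real.exp (θ * k) * Real.exp (-(θ * κ)) + m * D := by gcongr
        _ = ((m + 1 : ℕ) : ℝ) * D := by rw [hD]; push_cast; ring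
        _ ≤ _ := le_add_of_nonneg_left (by positivity)
  calc _ ≤ newProb m y *
        (Real.exp (θ * k) * (ρ ^ (J - (M - m)) * Real.exp (θ * excess k M n m y) + m * D)) +
      (1 - newProb m y) * (Real.exp (θ * k) *
        (ρ ^ (J - (M - m)) * Real.exp (θ * excess k M n m (y + 1)) + m * D)) := by
        gcongr
        · exact bulkPotential_le hρ0.le hD0 m y
        · exact bulkPotential_le hρ0.le hD0 m (y + 1)
    _ = Real.exp (θ * k) *
        (newProb m y * (ρ ^ (J - (M - m)) * Real.exp (θ * excess k M n m y) + m * D) +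
      (1 - newProb m y) *
        (ρ ^ (J - (M - m)) * Real.exp (θ * excess k M n m (y + 1)) + m * D)) := by ring
    _ ≤ Real.exp (θ * k) *
        (ρ ^ (J - (M - (m + 1))) * Real.exp (θ * excess k M n (m + 1) (y + 1)) +
        ((m + 1 : ℕ) : ℝ) * D) := by gcongr
    _ = _ := by rw [bulkPotential, if_pos hK]

/-! ### Reduction to the last `J` columns and conclusion -/

/-- The conditions on a bound `f` for tableaux of size `M × n`: it agrees with the Dyck bound of
`M + B` columns in the first `ℓ` rows, with that of `M` columns in the last `ℓ + 1` rows, and lies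
between the two everywhere. -/
structure IsPerturbedBound (k M B ℓ n : ℕ) (f : ℕ → ℤ) : Prop where
  low : ∀ y : ℕ, 1 ≤ y → y ≤ n → y ≤ ℓ → f y = dyckBound k (M + B) n y
  high : ∀ y : ℕ, 1 ≤ y → y ≤ n → n ≤ y + ℓ → f y = dyckBound k (M + B) n y - (B : ℤ)
  mid : ∀ y : ℕ, 1 ≤ y → y ≤ n → dyckBound k (M + B) n y - (B : ℤ) ≤ f y

/-- During the last `J` columns the walk is still in the top rows, where `f` is the Dyck bound of
`M` columns because `J ≤ ℓ`. -/
theorem walkProb_le_lastCond {k M B ℓ n J : ℕ} {f : ℕ → ℤ} (hf : IsPerturbedBound k M B ℓ n f)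
    (hJ : J ≤ ℓ) : walkProb (fun x y => (x : ℤ) ≤ f y) M n ≤ walkProb (lastCond k M n J) M n := by
  have h := walkProb_sub_le (E := fun x y => (x : ℤ) ≤ f y) (A := lastCond k M n J) (M := M)
    (n := n) (Φ := fun _ _ => 0) (fun _ _ => le_rfl) (by simp)
    (fun m y hym hm hy hr hE hA => by
      refine absurd (fun hlt => ?_) hA
      have h1 := hf.high (y + 1) (by omega) hy (by omega)
      have h2 : ((m + 1 : ℕ) : ℤ) ≤ f (y + 1) := hE
      rw [h1, dyckBound] at h2
      push_cast at h2 ⊢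
      linarith) M n le_rfl le_rfl (by omega)
  simpa using h

/-- The potential is the sum of `bulkPotential`, at least `1` at violations in rows from `K` on, and
`3 K * pairProb`, at least `1` at violations below `K`. The right side bounds its value at the start
`(M, n)`. -/
theorem lastCond_sub_walkProb_le {k M B ℓ n J β : ℕ} {f : ℕ → ℤ} {θ ρ K κ : ℝ} (hk : 2 ≤ k)
    (hf : IsPerturbedBound k M B ℓ n f) (hJ : J ≤ ℓ) (hB : B ≤ β) (hβ : 2 * β ≤ ℓ)
    (hM : k * n + 1 ≤ M + B) (hβn : β + 1 ≤ n) (hθ : 0 < θ) (hρ0 : 0 < ρ)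
    (hρ1 : ρ < 1) (hρ : ∀ p : ℝ, p ≤ 5 / (6 * k) →
      p * Real.exp (θ * (k - 1)) + (1 - p) * Real.exp (-θ) ≤ ρ) (hK : 0 ≤ K)
    (hκ : κ + β ≤ K / 4) :
    walkProb (lastCond k M n J) M n - walkProb (fun x y => (x : ℤ) ≤ f y) M n ≤
      Real.exp (θ * k) * (ρ ^ J + M * (Real.exp (θ * k) * Real.exp (-(θ * κ)))) + 3 * K / n := by
  set D := Real.exp (θ * k) * Real.exp (-(θ * κ)) with hD
  have hD0 : 0 ≤ D := by positivity
  have hB' : (B : ℝ) ≤ β := by exact_mod_cast hB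
  have hMn : (k : ℝ) * n - β ≤ M := by
    have : (k : ℝ) * n + 1 ≤ M + B := by exact_mod_cast hM
    linarith
  have h := walkProb_sub_le (E := lastCond k M n J) (A := fun x y => (x : ℤ) ≤ f y) (M := M)
    (n := n) (Φ := fun m y => bulkPotential k M n J θ ρ K D m y + 3 * K * pairProb m y)
    (fun m y => add_nonneg (bulkPotential_nonneg hρ0.le hD0 m y)
      (mul_nonneg (by positivity) (pairProb_nonneg m y)))
    (fun m y hym hm hy => by
      have h1 := bulkPotential_step (J := J) (K := K) (κ := κ) (κ' := β) (n := n) hk hθ hρ0 hρ1 hρ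
        hMn hκ hym hm
      have h2 := newProb_mul_pairProb_le m y hym
      have h3 := mul_le_mul_of_nonneg_left h2 (by positivity : 0 ≤ 3 * K)
      rw [← hD] at h1
      linarith)
    (fun m y hym hm hy hr hE hA => by
      have hA' : f (y + 1) < (m : ℤ) + 1 := by
        have : ¬ (((m + 1 : ℕ) : ℤ) ≤ f (y + 1)) := hA
        push_cast at this
        linarith
      have hmid := hf.mid (y + 1) (by omega) hy
      have hMJ : m + 1 + J ≤ M := by
        by_contra hlt
        have h1 := hf.high (y + 1) (by omega) hy (by omega)
        have h2 := hE (by omega)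
        rw [h1, dyckBound] at hA'
        push_cast at h2 hA'
        linarith
      by_cases hKy : K ≤ ((y + 1 : ℕ) : ℝ)
      · have h1 : 1 ≤ bulkPotential k M n J θ ρ K D (m + 1) (y + 1) := by
          -- A violation means excess at least `-k`, which the prefactor `exp (θ k)` compensates.
          rw [bulkPotential, if_pos hKy, show J - (M - (m + 1)) = 0 by omega, pow_zero, one_mul,
            mul_add, ← Real.exp_add]
          have h2 : (1 : ℝ) ≤ Real.exp (θ * k + θ * excess k M n (m + 1) (y + 1)) := by
            apply Real.one_le_exp
            rw [← mul_add]
            refine mul_nonneg hθ.le ?_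
            have h3 : dyckBound k (M + B) n (y + 1) - (B : ℤ) ≤ (m : ℤ) + 1 := by linarith
            rw [dyckBound] at h3
            have h4 := (Int.cast_le (R := ℝ)).2 h3
            push_cast at h4
            simp only [excess]
            push_cast
            linarith
          have h3 : 0 ≤ Real.exp (θ * k) * (((m + 1 : ℕ) : ℝ) * D) := by positivity
          linarith
        have := mul_nonneg (by positivity : 0 ≤ 3 * K) (pairProb_nonneg (m + 1) (y + 1))
        linarith
      · have h1 : 3 * (y + 1) ≤ 2 * (m + 1) := by
          have hky : 2 * (y : ℤ) ≤ k * y := by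
            have : (2 : ℤ) ≤ k := by exact_mod_cast hk
            gcongr
          have hM' : (k : ℤ) * n + 1 ≤ M + B := by exact_mod_cast hM
          -- In the first `ℓ` rows `f` is unshifted, so a violation has `m + 1 > 2 y + 1`. Beyond
          -- them the shift `B ≤ β ≤ ℓ / 2` costs at most half of `y + 1`.
          by_cases hyl : y + 1 ≤ ℓ
          · rw [hf.low (y + 1) (by omega) hy hyl, dyckBound] at hA'
            push_cast at hA'
            have : 2 * (y : ℤ) + 1 < m + 1 := by linarith
            omega
          · rw [dyckBound] at hmid
            push_cast at hmid
            have : 2 * (y : ℤ) + 1 - B < m + 1 := by linarith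
            omega
        have h2 := le_pairProb_succ h1
        have h3 : 1 ≤ 3 * K * pairProb (m + 1) (y + 1) := by
          rw [not_le] at hKy
          push_cast at hKy
          have hK0 : 0 < K := lt_trans (by positivity) hKy
          calc (1 : ℝ) ≤ K / ((y : ℝ) + 1) := (one_le_div (by positivity)).2 hKy.le
            _ = 3 * K * (1 / (3 * ((y : ℝ) + 1))) := by field_simp
            _ ≤ _ := by gcongr
        have := bulkPotential_nonneg (k := k) (M := M) (n := n) (J := J) (θ := θ) (K := K) hρ0.le
          hD0 (m + 1) (y + 1)
        linarith) M n le_rfl le_rfl (by omega)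
  refine h.trans (add_le_add ?_ ?_)
  · refine (bulkPotential_le hρ0.le hD0 M n).trans (le_of_eq ?_)
    simp [excess]
  · obtain ⟨n, rfl⟩ : ∃ n', n = n' + 1 := ⟨n - 1, by omega⟩
    have hnM : n + 1 ≤ M := by nlinarith
    obtain ⟨M, rfl⟩ : ∃ M', M = M' + 1 := ⟨M - 1, by omega⟩
    have := mul_le_mul_of_nonneg_left (pairProb_succ_le (m := M) (y := n) (by omega))
      (by positivity : 0 ≤ 3 * K)
    push_cast
    rwa [mul_one_div] at this

/-- `J` is chosen before `n` and the bound, so one window serves both `f` and the unperturbed Dyck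
bound. -/
theorem exists_window {k : ℕ} (hk : 2 ≤ k) (β : ℕ) (C : ℝ) {ε : ℝ} (hε : 0 < ε) :
    ∃ J : ℕ, ∀ᶠ n : ℕ in atTop, ∀ (M B ℓ : ℕ) (f : ℕ → ℤ), IsPerturbedBound k M B ℓ n f →
      J ≤ ℓ → B ≤ β → 2 * β ≤ ℓ → k * n + 1 ≤ M + B → (M : ℝ) ≤ C * n →
      |walkProb (fun x y => (x : ℤ) ≤ f y) M n - walkProb (lastCond k M n J) M n| ≤ ε := by
  obtain ⟨θ, ρ, hθ, hρ0, hρ1, hρ⟩ := exists_exp_contraction (k := k) (by omega)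
  have hJ : ∀ᶠ J : ℕ in atTop, Real.exp (θ * k) * ρ ^ J < ε / 3 := by
    have h := (tendsto_pow_atTop_nhds_zero_of_lt_one hρ0.le hρ1).const_mul (Real.exp (θ * k))
    rw [mul_zero] at h
    exact h.eventually_lt_const (by positivity)
  obtain ⟨J, hJ⟩ := hJ.exists
  refine ⟨J, ?_⟩
  set c : ℝ := θ * (ε / 72) with hc
  have hc0 : 0 < c := by positivity
  have hdecay : ∀ᶠ n : ℕ in atTop,
      Real.exp (θ * k) * (C * n * (Real.exp (θ * k) * Real.exp (-(c * n)))) < ε / 3 := by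
    have h1 : Tendsto (fun n : ℕ => c * (n : ℝ)) atTop atTop :=
      tendsto_natCast_atTop_atTop.const_mul_atTop hc0
    have h2 := ((Real.tendsto_pow_mul_exp_neg_atTop_nhds_zero 1).comp h1).const_mul
      (Real.exp (θ * k) * Real.exp (θ * k) * C / c)
    rw [mul_zero] at h2
    filter_upwards [h2.eventually_lt_const (by positivity : (0 : ℝ) < ε / 3)] with n hn
    refine lt_of_eq_of_lt ?_ hn
    simp only [Function.comp_apply, pow_one]
    field_simp
  have hβ : ∀ᶠ n : ℕ in atTop, (β : ℝ) ≤ ε / 72 * n :=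
    (tendsto_natCast_atTop_atTop.const_mul_atTop (by positivity)).eventually_ge_atTop _
  filter_upwards [hdecay, hβ, eventually_ge_atTop (β + 1)] with n hn hβn hn1 M B ℓ f hf hJℓ hB hℓ
    hMn hMC
  have h1 := walkProb_le_lastCond hf hJℓ
  -- `K` makes the low-row term `3 K / n` equal to `ε / 3`, and `κ = K / 8` leaves room for `β ≤ K /
  -- 8`.
  have h2 := lastCond_sub_walkProb_le (K := ε / 9 * n) (κ := ε / 72 * n) hk hf hJℓ hB hℓ hMn hn1 hθ
    hρ0 hρ1 hρ (by positivity) (by linarith)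
  have hn0 : (0 : ℝ) < n := by
    have : 0 < n := by omega
    exact_mod_cast this
  have h3 : 3 * (ε / 9 * n) / n = ε / 3 := by
    field_simp
    norm_num
  have h4 : Real.exp (θ * k) * (M * (Real.exp (θ * k) * Real.exp (-(θ * (ε / 72 * n))))) ≤
      Real.exp (θ * k) * (C * n * (Real.exp (θ * k) * Real.exp (-(c * n)))) := by
    rw [show θ * (ε / 72 * n) = c * n by rw [hc]; ring]
    gcongr
  rw [abs_sub_comm, abs_of_nonneg (sub_nonneg.2 h1)]
  rw [h3, mul_add] at h2
  linarith

theorem IsPerturbedBound.dyckBound (k N ℓ n : ℕ) :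
    IsPerturbedBound k N 0 ℓ n (dyckBound k N n) where
  low := fun _ _ _ _ => rfl
  high := fun _ _ _ _ => by simp
  mid := fun _ _ _ => by simp

theorem proposition6 (k : ℕ) (hk : 2 ≤ k) (N M B ℓ : ℕ → ℕ) (f : ℕ → ℕ → ℤ)
    (hN : (fun n => (N n : ℝ)) =O[atTop] (fun n => (n : ℝ)))
    (hB : (fun n => (B n : ℝ)) =O[atTop] (fun _ => (1 : ℝ)))
    (hℓ : (fun n : ℕ => Real.sqrt (n : ℝ)) =o[atTop] (fun n => (ℓ n : ℝ)))
    (hM : ∀ᶠ n in atTop, M n + B n = N n)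
    (hf_low : ∀ᶠ n in atTop, ∀ y : ℕ, 1 ≤ y → y ≤ n → y ≤ ℓ n →
      f n y = dyckBound k (N n) n y)
    (hf_high : ∀ᶠ n in atTop, ∀ y : ℕ, 1 ≤ y → y ≤ n → n ≤ y + ℓ n →
      f n y = dyckBound k (N n) n y - (B n : ℤ))
    (hf_mid : ∀ᶠ n in atTop, ∀ y : ℕ, 1 ≤ y → y ≤ n →
      dyckBound k (N n) n y - (B n : ℤ) ≤ f n y ∧ f n y ≤ dyckBound k (N n) n y) :
    (fun n => proportionBelow (M n) n (f n) -
        proportionBelow (N n) n (dyckBound k (N n) n))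
      =o[atTop] (fun _ => (1 : ℝ)) := by
  obtain ⟨C, hC⟩ := hN.bound
  obtain ⟨b, hb⟩ := hB.bound
  have hℓ' : Tendsto ℓ atTop atTop := by
    have h1 : Tendsto (fun n : ℕ => Real.sqrt (n : ℝ)) atTop atTop :=
      Real.tendsto_sqrt_atTop.comp tendsto_natCast_atTop_atTop
    refine tendsto_natCast_atTop_iff.1 (tendsto_atTop_mono' _ ?_ h1)
    filter_upwards [hℓ.bound one_pos] with n hn
    rw [one_mul, Real.norm_of_nonneg (Real.sqrt_nonneg _),
      Real.norm_of_nonneg (Nat.cast_nonneg _)] at hn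
    exact hn
  set β : ℕ := ⌈b⌉₊ with hβ
  rw [isLittleO_one_iff, Metric.tendsto_nhds]
  intro ε hε
  obtain ⟨J, hJ⟩ := exists_window hk β C (ε := ε / 4) (by positivity)
  have hlarge : ∀ᶠ n : ℕ in atTop, (J : ℝ) * β + ε / 4 * (β + J) ≤ ε / 4 * n :=
    (tendsto_natCast_atTop_atTop.const_mul_atTop (by positivity)).eventually_ge_atTop _
  filter_upwards [hC, hb, hM, hf_low, hf_high, hf_mid, hJ, hlarge, hℓ'.eventually_ge_atTop J,
    hℓ'.eventually_ge_atTop (2 * β), eventually_ge_atTop (β + J + 1)] with n hC hb hM hlow hhigh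
    hmid hJ hlarge hJℓ hβℓ hn
  rw [dist_zero_right, Real.norm_eq_abs]
  rw [Real.norm_of_nonneg (Nat.cast_nonneg _), Real.norm_of_nonneg (Nat.cast_nonneg _)] at hC
  have hBβ : B n ≤ β := by
    rw [Real.norm_of_nonneg (Nat.cast_nonneg _), norm_one, mul_one] at hb
    exact_mod_cast hb.trans (Nat.le_ceil b)
  -- If `N ≤ k n`, both bounds are nonpositive in row `1`, so no tableau is dominated and both
  -- proportions vanish.
  rcases Nat.lt_or_ge (N n) (k * n + 1) with hsmall | hbig
  · have h0 : dyckBound k (N n) n 1 ≤ 0 := by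
      have : (N n : ℤ) ≤ k * n := by exact_mod_cast Nat.lt_succ_iff.1 hsmall
      simp only [dyckBound, Nat.cast_one, sub_add_cancel]
      linarith
    rw [proportionBelow_eq_zero (by omega) h0,
      proportionBelow_eq_zero (by omega) ((hmid 1 le_rfl (by omega)).2.trans h0)]
    simpa using hε
  rw [← hM] at hlow hhigh hmid hbig hC ⊢
  have hf : IsPerturbedBound k (M n) (B n) (ℓ n) n (f n) :=
    ⟨hlow, hhigh, fun y h1 h2 => (hmid y h1 h2).1⟩
  have hMC : (M n : ℝ) ≤ C * n := by
    have : (0 : ℝ) ≤ B n := Nat.cast_nonneg _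
    push_cast at hC
    linarith
  have h1 := hJ _ _ _ _ hf hJℓ hBβ hβℓ hbig hMC
  -- The Dyck bound is the perturbed bound with shift `0` and `M + B` columns.
  have h2 := hJ _ _ _ _ (IsPerturbedBound.dyckBound k (M n + B n) (ℓ n) n) hJℓ (Nat.zero_le _) hβℓ
    hbig hC
  have hMn : 2 * n + 1 ≤ M n + B n := by nlinarith
  have h3 := abs_walkProb_lastCond_sub_le (k := k) (B := B n) (J := J) (n := n) (M := M n)
    (by omega) (by omega)
  have h4 : (J : ℝ) * (B n / ((M n : ℝ) - J + 1 - n)) ≤ ε / 4 := by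
    have hMn' : (2 : ℝ) * n + 1 ≤ M n + B n := by exact_mod_cast hMn
    have hBβ' : (B n : ℝ) ≤ β := by exact_mod_cast hBβ
    have hn' : (β : ℝ) + J + 1 ≤ n := by exact_mod_cast hn
    rw [← mul_div_assoc, div_le_iff₀ (by linarith)]
    calc (J : ℝ) * B n ≤ J * β := by gcongr
      _ ≤ ε / 4 * (n - (β + J)) := by linarith
      _ ≤ ε / 4 * ((M n : ℝ) - J + 1 - n) :=
          mul_le_mul_of_nonneg_left (by linarith) (by positivity)
  rw [proportionBelow_eq, proportionBelow_eq]
  change |walkProb _ _ _ - walkProb _ _ _| < ε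
  have h5 := abs_sub_le (walkProb (fun x y => (x : ℤ) ≤ f n y) (M n) n)
    (walkProb (lastCond k (M n) n J) (M n) n)
    (walkProb (fun x y => (x : ℤ) ≤ dyckBound k (M n + B n) n y) (M n + B n) n)
  have h6 := abs_sub_le (walkProb (lastCond k (M n) n J) (M n) n)
    (walkProb (lastCond k (M n + B n) n J) (M n + B n) n)
    (walkProb (fun x y => (x : ℤ) ≤ dyckBound k (M n + B n) n y) (M n + B n) n)
  rw [abs_sub_comm] at h2
  linarith
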